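/- Let $G$ be a nonabelian, connected and simply connected nilpotent (finite-dimensional, real) Lie group. Then there exists a separated set $\Gamma\subset G$ such that $\Gamma^{-1}=\{\gamma^{-1}:\gamma\in\Gamma\}$ is not relatively separated. Here a subset $\Gamma\subset G$ is called \emph{separated} if there is a relatively compact neighborhood $V$ of the identity such that the sets $xV$, $x\in\Gamma$, are pairwise disjoint, and \emph{relatively separated} if $\sup_{x\in G}\sharp(\Gamma\cap xU)<\infty$ for some (equivalently, for every) relatively compact neighborhood $U$ of the identity. -/

import Mathlib

open scoped Manifold ContDiff Topology Pointwise

/-- `U` is a relatively compact neighborhood of the identity. It need not be open. -/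
def IsRelCompactNhdOne {G : Type*} [Group G] [TopologicalSpace G] (U : Set G) : Prop :=
  U ∈ 𝓝 (1 : G) ∧ IsCompact (closure U)

/-- `Γ` is (left) relatively separated: for some relatively compact neighborhood `U` of the
identity, the cardinalities of the sets `Γ ∩ xU`, `x ∈ G`, have a finite supremum. -/
def RelativelySeparated {G : Type*} [Group G] [TopologicalSpace G] (Γ : Set G) : Prop :=
  ∃ U : Set G, IsRelCompactNhdOne U ∧ ∃ N : ℕ, ∀ x : G, (Γ ∩ x • U).encard ≤ N

/-- `Γ` is separated: for some relatively compact neighborhood `V` of the identity, the sets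
`xV`, `x ∈ Γ`, are pairwise disjoint. -/
def Separated {G : Type*} [Group G] [TopologicalSpace G] (Γ : Set G) : Prop :=
  ∃ V : Set G, IsRelCompactNhdOne V ∧ Γ.PairwiseDisjoint (fun x : G => x • V)

/-!
The sets `Γ` separated with `Γ⁻¹` not relatively separated come from elements near the identity
that can be conjugated far away. Suppose that for all `N`, every compact set `W` and every
neighborhood `U` of `1` there are `u ∈ U` and `y` with `y⁻¹ uᵏ y ∉ W` for `1 ≤ k ≤ N`. Then the `N`
points `uⁱ y`, `i < N`, are pairwise far apart for left translates, while their inverses `y⁻¹ u⁻ⁱ`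
all lie in one small left translate of a neighborhood of `1`. Such finite clusters, for smaller and
smaller `U` and larger and larger `N`, can be chosen successively far from each other, and their
union is `Γ` (`exists_separated_inv_not_relativelySeparated`).

To find `u` and `y`, let `Z_j` be the upper central series. Noncentral behaviour is visible near the
identity: if `Z_{j+1}` is proper, there are `u ∈ Z_{j+2} \ Z_{j+1}` arbitrarily close to `1`
(`exists_mem_upperCentralSeries_succ_notMem`). For a suitable `y` the element `z = u⁻¹ y⁻¹ u y` lies
in `Z_{j+1} \ Z_j`, it is central modulo `Z_j`, and `y⁻ⁿ uᵏ yⁿ ≡ uᵏ zⁿᵏ` modulo `Z_j`. It remains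
to see that the powers of `z` escape from all sets `K Z_j` with `K` compact (`exists_conj_pow_notMem`).

* If the nilpotency class is at least three, take `j = 1`. Here simple connectedness plays no role:
  `g ↦ ⁅z, g⁆` is a nontrivial homomorphism to the center, and along one-parameter subgroups
  `⁅z, exp X⁆ = ⁅zⁿ, exp (X / n)⁆` would tend to `1` along powers `zⁿ` staying in `K Z_1`
  (`exists_forall_pow_notMem_mul_center`).
* If the class is two, take `j = 0`. The exponential map is then a homomorphism from the Lie algebra
  with the Baker–Campbell–Hausdorff group law `X + Y + ⁅X, Y⁆ / 2` onto `G`, and a local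
  homeomorphism at `0`. Hence it is a covering map (`isCoveringMap_lieExp`), and a homeomorphism as
  `G` is simply connected. Since `zⁿ = exp (n C)` with `C ≠ 0`, the powers of `z` escape
  (`exists_forall_pow_notMem_of_simplyConnected`).

The exponential map is built from the global integral curves of left-invariant vector fields.
-/

open scoped commutatorElement

/-! ### Separated sets from conjugation -/

theorem commute_mk'_iff {G : Type*} [Group G] (N : Subgroup G) [N.Normal] (x g : G) :
    Commute (QuotientGroup.mk' N x) (QuotientGroup.mk' N g) ↔ ⁅x, g⁆ ∈ N := by
  rw [← commutatorElement_eq_one_iff_commute, ← map_commutatorElement, QuotientGroup.mk'_apply,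
    QuotientGroup.eq_one_iff]

section TopologicalGroup

variable {G : Type*} [Group G] [TopologicalSpace G] [IsTopologicalGroup G]

theorem eventually_forall_inv_pow_mem {U : Set G} (hU : U ∈ 𝓝 (1 : G)) (N : ℕ) :
    ∀ᶠ u in 𝓝 (1 : G), ∀ i ≤ N, (u ^ i)⁻¹ ∈ U := by
  refine (Filter.eventually_all_finite (Set.finite_Iic N)).2 fun i _ => ?_
  have h : Filter.Tendsto (fun u : G => (u ^ i)⁻¹) (𝓝 1) (𝓝 1) := by
    have : Continuous fun u : G => (u ^ i)⁻¹ := by fun_prop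
    simpa using this.tendsto 1
  exact h hU

omit [IsTopologicalGroup G] in
/-- Tube lemma for maps `f` with `f 1 k = 1` for all `k`, such as conjugation or the commutator. -/
theorem eventually_forall_mem_of_isCompact {K W : Set G} (hK : IsCompact K)
    (hW : W ∈ 𝓝 (1 : G)) {f : G → G → G} (hf : Continuous fun p : G × G => f p.1 p.2)
    (h1 : ∀ k, f 1 k = 1) : ∀ᶠ u in 𝓝 (1 : G), ∀ k ∈ K, f u k ∈ W := by
  refine hK.eventually_forall_of_forall_eventually fun k _ => ?_
  have := hf.tendsto (1, k)
  simp only [h1] at this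
  exact this hW

/-- One cluster of the construction: the points `uⁱ y`, `i < N`, where `u` is so close to `1` that
the `u⁻ⁱ` lie in `U`, and conjugation by `y` moves the powers of `u` out of `W`. As `y` cannot
belong to a given compact set if `u` is close to `1`, the cluster avoids `K`. -/
theorem exists_finite_of_conj_escape [T2Space G] {V W : Set G} (hV : V ∈ 𝓝 (1 : G))
    (hVc : IsCompact V) (hW : W ∈ 𝓝 (1 : G)) (hWi : W⁻¹ = W)
    (h : ∀ U ∈ 𝓝 (1 : G), ∀ N : ℕ, ∃ u ∈ U, ∃ y : G, ∀ k, 1 ≤ k → k ≤ N → y⁻¹ * u ^ k * y ∉ W)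
    {K : Set G} (hK : IsCompact K) {U : Set G} (hU : U ∈ 𝓝 (1 : G)) (N : ℕ) :
    ∃ F : Set G, F.Finite ∧ Disjoint F K ∧ (∀ x ∈ F, ∀ x' ∈ F, x ≠ x' → x⁻¹ * x' ∉ W) ∧
      ∃ x : G, (N : ℕ∞) ≤ (F⁻¹ ∩ x • U).encard := by
  have h1 := eventually_forall_inv_pow_mem (Filter.inter_mem hU hV) N
  have h2 := eventually_forall_mem_of_isCompact (hVc.mul hK) hW
    (f := fun u y => y⁻¹ * u * y) (by fun_prop) (by simp)
  -- `N + 1` rather than `N`: the exponent `k = 1` is needed even for `N = 0`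
  obtain ⟨u, ⟨hu1, hu2⟩, y, hy⟩ := h _ (h1.and h2) (N + 1)
  have hW1 : (1 : G) ∈ W := mem_of_mem_nhds hW
  have key : ∀ i j : ℕ, i < j → j < N → (u ^ i * y)⁻¹ * (u ^ j * y) ∉ W := by
    intro i j hij hj
    have := hy (j - i) (by omega) (by omega)
    have e : u ^ j = u ^ i * u ^ (j - i) := by rw [← pow_add]; congr 1; omega
    rw [e]
    convert this using 1
    group
  have key' : ∀ i j : ℕ, i ≠ j → i < N → j < N → (u ^ i * y)⁻¹ * (u ^ j * y) ∉ W := by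
    intro i j hij hi hj
    rcases lt_or_gt_of_ne hij with hlt | hlt
    · exact key i j hlt hj
    · intro hmem
      apply key j i hlt hi
      rw [← hWi]
      simpa [mul_assoc] using hmem
  refine ⟨(fun i : ℕ => u ^ i * y) '' Set.Iio N, (Set.finite_Iio N).image _, ?_, ?_, y⁻¹, ?_⟩
  · rw [Set.disjoint_left]
    rintro _ ⟨i, hi, rfl⟩ hmem
    have : y ∈ V * K := ⟨(u ^ i)⁻¹, (hu1 i (le_of_lt hi)).2, _, hmem, by simp⟩
    exact hy 1 le_rfl (by omega) (by simpa using hu2 y this)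
  · rintro _ ⟨i, hi, rfl⟩ _ ⟨j, hj, rfl⟩ hne
    exact key' i j (fun e => hne (by simp [e])) hi hj
  · have hsub : (fun i : ℕ => (u ^ i * y)⁻¹) '' Set.Iio N ⊆
        ((fun i : ℕ => u ^ i * y) '' Set.Iio N)⁻¹ ∩ y⁻¹ • U := by
      rintro _ ⟨i, hi, rfl⟩
      refine ⟨by simpa using ⟨i, hi, rfl⟩, (u ^ i)⁻¹, (hu1 i (le_of_lt hi)).1, by simp⟩
    refine le_trans ?_ (Set.encard_le_encard hsub)
    rw [Set.InjOn.encard_image]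
    · rw [← Finset.coe_Iio, Set.encard_coe_eq_coe_finsetCard, Nat.card_Iio]
    · intro i hi j hj hij
      by_contra hne
      apply key' i j hne hi hj
      have : u ^ i * y = u ^ j * y := inv_injective hij
      rw [this]
      simpa using hW1

/-- If arbitrarily small elements, together with many of their powers, can be conjugated out of
every compact set, then there is a separated set whose inverse is not relatively separated. -/
theorem exists_separated_inv_not_relativelySeparated [T2Space G] [WeaklyLocallyCompactSpace G]
    [FirstCountableTopology G]
    (h : ∀ W : Set G, IsCompact W → ∀ U ∈ 𝓝 (1 : G), ∀ N : ℕ,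
      ∃ u ∈ U, ∃ y : G, ∀ k, 1 ≤ k → k ≤ N → y⁻¹ * u ^ k * y ∉ W) :
    ∃ Γ : Set G, Separated Γ ∧ ¬ RelativelySeparated Γ⁻¹ := by
  obtain ⟨V, hVc, hV⟩ := exists_compact_mem_nhds (1 : G)
  have hWc : IsCompact (V * V⁻¹) := hVc.mul hVc.inv
  have hV1 : (1 : G) ∈ V := mem_of_mem_nhds hV
  have hWn : V * V⁻¹ ∈ 𝓝 (1 : G) :=
    Filter.mem_of_superset hV fun v hv => ⟨v, hv, 1, by simpa using hV1, by simp⟩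
  obtain ⟨U, hU⟩ := (𝓝 (1 : G)).exists_antitone_basis
  have level : ∀ (K : TopologicalSpace.Compacts G) (n : ℕ), ∃ F : Set G, F.Finite ∧
      Disjoint F K ∧ (∀ x ∈ F, ∀ x' ∈ F, x ≠ x' → x⁻¹ * x' ∉ V * V⁻¹) ∧
      ∃ x : G, (n : ℕ∞) ≤ (F⁻¹ ∩ x • U n).encard := fun K n =>
    exists_finite_of_conj_escape hV hVc hWn (by simp) (h _ hWc) K.isCompact
      (hU.1.mem_of_mem trivial) n
  choose F hFfin hFdisj hFsep hFcard using level
  -- `S n` contains the right `V * V⁻¹`-neighborhoods of all clusters before the `n`-th one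
  let S : ℕ → TopologicalSpace.Compacts G := fun n => Nat.rec ⊥
    (fun n K => K ⊔ ⟨F K n * (V * V⁻¹), (hFfin K n).isCompact.mul hWc⟩) n
  have hS : ∀ n, S (n + 1) = S n ⊔ ⟨F (S n) n * (V * V⁻¹), (hFfin (S n) n).isCompact.mul hWc⟩ :=
    fun n => rfl
  have hmono : Monotone S := monotone_nat_of_le_succ fun n => by rw [hS]; exact le_sup_left
  have hcross : ∀ n m, n < m → ∀ x ∈ F (S n) n, ∀ x' ∈ F (S m) m, x⁻¹ * x' ∉ V * V⁻¹ := by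
    intro n m hnm x hx x' hx' hmem
    have h1 : x' ∈ S (n + 1) := by
      rw [hS]
      exact Or.inr ⟨x, hx, _, hmem, by simp⟩
    exact Set.disjoint_left.1 (hFdisj (S m) m) hx' (hmono hnm h1)
  have hsep : ∀ x ∈ ⋃ n, F (S n) n, ∀ x' ∈ ⋃ n, F (S n) n, x ≠ x' → x⁻¹ * x' ∉ V * V⁻¹ := by
    intro x hx x' hx' hne
    obtain ⟨n, hn⟩ := Set.mem_iUnion.1 hx
    obtain ⟨m, hm⟩ := Set.mem_iUnion.1 hx'
    rcases lt_trichotomy n m with hlt | rfl | hlt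
    · exact hcross n m hlt x hn x' hm
    · exact hFsep _ _ x hn x' hm hne
    · intro hmem
      apply hcross m n hlt x' hm x hn
      have : V * V⁻¹ = (V * V⁻¹)⁻¹ := by simp
      rw [this]
      exact Set.mem_inv.2 (by rwa [mul_inv_rev, inv_inv])
  refine ⟨⋃ n, F (S n) n, ⟨V, ⟨hV, hVc.closure⟩, ?_⟩, ?_⟩
  · intro x hx x' hx' hne
    refine Set.disjoint_left.2 ?_
    rintro _ ⟨v, hv, rfl⟩ ⟨v', hv', he⟩
    refine hsep x hx x' hx' hne ⟨v, hv, v'⁻¹, by simpa using hv', ?_⟩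
    have he' : x' * v' = x * v := he
    change v * v'⁻¹ = x⁻¹ * x'
    rw [eq_inv_mul_iff_mul_eq, ← mul_assoc, ← he', mul_inv_cancel_right]
  · rintro ⟨U', ⟨hU', -⟩, N, hN⟩
    obtain ⟨n, -, hn⟩ := hU.1.mem_iff.1 hU'
    -- the cluster with index `m ≥ N + 1` has at least `m` points in a translate of `U m ⊆ U'`
    have hsub : U (max n (N + 1)) ⊆ U' := (hU.2 (le_max_left _ _)).trans hn
    obtain ⟨x, hx⟩ := hFcard (S (max n (N + 1))) (max n (N + 1))
    have h1 := hx.trans ((Set.encard_le_encard (Set.inter_subset_inter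
      (Set.inv_subset_inv.2 (Set.subset_iUnion (fun n => F (S n) n) (max n (N + 1))))
      (Set.smul_set_mono hsub))).trans (hN x))
    have h2 : max n (N + 1) ≤ N := by exact_mod_cast h1
    have := le_max_right n (N + 1)
    omega


theorem Subgroup.eq_top_of_mem_nhds_one [ConnectedSpace G] {H : Subgroup G}
    (hH : (H : Set G) ∈ 𝓝 (1 : G)) : H = ⊤ := by
  have ho : IsOpen (H : Set G) := H.isOpen_of_mem_nhds hH
  exact SetLike.coe_injective (IsClopen.eq_univ ⟨H.isClosed_of_isOpen ho, ho⟩ ⟨1, H.one_mem⟩)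

/-! ### The upper central series near the identity -/

/-- In a connected nilpotent group a proper term of the upper central series is strictly smaller
than the next one even near the identity. If `x ∈ Z_{i+2}` then, modulo `Z_i`, the elements `g` with
`⁅x, g⁆ ∈ Z_i` form a subgroup; were `Z_{i+1}` contained in `Z_i` near `1`, this subgroup
would be open, hence everything, and the upper central series would stop growing at `Z_{i+1}`. -/
theorem exists_mem_upperCentralSeries_succ_notMem [ConnectedSpace G] [Group.IsNilpotent G] {i : ℕ}
    (hi : Subgroup.upperCentralSeries G i ≠ ⊤) {U : Set G} (hU : U ∈ 𝓝 (1 : G)) :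
    ∃ u ∈ U, u ∈ Subgroup.upperCentralSeries G (i + 1) ∧ u ∉ Subgroup.upperCentralSeries G i := by
  by_contra hcon
  push Not at hcon
  have hstat : Subgroup.upperCentralSeries G (i + 1) = Subgroup.upperCentralSeries G (i + 2) := by
    refine le_antisymm (Subgroup.upperCentralSeries_mono G (Nat.le_succ _)) fun x hx => ?_
    rw [Subgroup.mem_upperCentralSeries_succ_iff] at hx ⊢
    let q := QuotientGroup.mk' (Subgroup.upperCentralSeries G i)
    have hq : ∀ g, g ∈ (Subgroup.centralizer {q x}).comap q ↔
        ⁅x, g⁆ ∈ Subgroup.upperCentralSeries G i := by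
      intro g
      rw [Subgroup.mem_comap, Subgroup.mem_centralizer_singleton_iff, ← commute_mk'_iff]
      exact eq_comm
    have htop : (Subgroup.centralizer {q x}).comap q = ⊤ := by
      apply Subgroup.eq_top_of_mem_nhds_one
      have hc : Filter.Tendsto (fun g : G => ⁅x, g⁆) (𝓝 1) (𝓝 1) := by
        have : Continuous fun g : G => x * g * x⁻¹ * g⁻¹ := by fun_prop
        simpa using! this.tendsto 1
      filter_upwards [hc hU] with g hg
      exact (hq g).2 (hcon _ hg (hx g))
    intro g
    rw [← hq, htop]
    trivial
  have htop := Subgroup.upperCentralSeries.eq_top (by omega) hstat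
  apply hi
  apply Subgroup.eq_top_of_mem_nhds_one
  filter_upwards [hU] with u hu
  exact hcon u hu (by rw [htop]; trivial)

/-- If the powers of every element of `Z_{j+1} \ Z_j` leave the sets `K * Z_j`, `K` compact, then
elements arbitrarily close to `1` can be conjugated out of any compact set, together with
many of their powers: for `u ∈ Z_{j+2}` and `z = u⁻¹y⁻¹uy`, which is central modulo `Z_j`, one has
`y⁻ⁿ uᵏ yⁿ ≡ uᵏ zⁿᵏ` modulo `Z_j`. -/
theorem exists_conj_pow_notMem [ConnectedSpace G] [Group.IsNilpotent G]
    [WeaklyLocallyCompactSpace G] {j : ℕ} (hj : Subgroup.upperCentralSeries G (j + 1) ≠ ⊤)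
    (hesc : ∀ z ∈ Subgroup.upperCentralSeries G (j + 1), z ∉ Subgroup.upperCentralSeries G j →
      ∀ K : Set G, IsCompact K → ∃ n₀ : ℕ, ∀ n ≥ n₀,
        z ^ n ∉ K * (Subgroup.upperCentralSeries G j : Set G))
    {W : Set G} (hW : IsCompact W) {U : Set G} (hU : U ∈ 𝓝 (1 : G)) (N : ℕ) :
    ∃ u ∈ U, ∃ y : G, ∀ k, 1 ≤ k → k ≤ N → y⁻¹ * u ^ k * y ∉ W := by
  obtain ⟨V, hVc, hV⟩ := exists_compact_mem_nhds (1 : G)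
  obtain ⟨u, ⟨huU, huV⟩, hu1, hu2⟩ := exists_mem_upperCentralSeries_succ_notMem hj
    (Filter.inter_mem hU (eventually_forall_inv_pow_mem hV N))
  -- with `z = ⁅u⁻¹, y⁆` one has `y * u * y⁻¹ = u * z`, which explains the inverses below
  rw [← inv_mem_iff] at hu1 hu2
  rw [Subgroup.mem_upperCentralSeries_succ_iff] at hu1 hu2
  push Not at hu2
  obtain ⟨y, hy⟩ := hu2
  let z := ⁅u⁻¹, y⁆
  obtain ⟨n₀, hn₀⟩ := hesc z (hu1 y) hy (V * W) (hVc.mul hW)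
  refine ⟨u, huU, y⁻¹ ^ (n₀ + 1), fun k hk1 hkN hmem => ?_⟩
  let q := QuotientGroup.mk' (Subgroup.upperCentralSeries G j)
  have hzc : ∀ g : G, Commute (q z) (q g) := by
    intro g
    rw [commute_mk'_iff]
    exact Subgroup.mem_upperCentralSeries_succ_iff.1 (hu1 y) g
  have h1 : ∀ n : ℕ, q y ^ n * q u * (q y ^ n)⁻¹ = q u * q z ^ n := by
    intro n
    induction n with
    | zero => simp
    | succ n ih =>
      have e1 : q y * q u * (q y)⁻¹ = q u * q z := by
        simp only [← map_mul, ← map_inv]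
        congr 1
        simp only [z, commutatorElement_def]
        group
      calc q y ^ (n + 1) * q u * (q y ^ (n + 1))⁻¹
          = q y * (q y ^ n * q u * (q y ^ n)⁻¹) * (q y)⁻¹ := by rw [pow_succ']; group
        _ = q y * q u * (q z ^ n * (q y)⁻¹) := by rw [ih]; group
        _ = q y * q u * ((q y)⁻¹ * q z ^ n) := by
          rw [((hzc y).pow_left n).inv_right.eq]
        _ = q u * q z ^ (n + 1) := by rw [← mul_assoc, e1, pow_succ', mul_assoc]
  have h2 : q ((y⁻¹ ^ (n₀ + 1))⁻¹ * u ^ k * y⁻¹ ^ (n₀ + 1)) = q (u ^ k * z ^ ((n₀ + 1) * k)) := by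
    have e : (y⁻¹ ^ (n₀ + 1))⁻¹ * u ^ k * y⁻¹ ^ (n₀ + 1) =
        (y ^ (n₀ + 1) * u * (y ^ (n₀ + 1))⁻¹) ^ k := by
      rw [conj_pow, inv_pow, inv_inv]
    rw [e, map_pow, map_mul, map_mul, map_inv, map_pow, h1, ((hzc u).symm.pow_right _).mul_pow,
      ← pow_mul, map_mul, map_pow, map_pow]
  refine hn₀ ((n₀ + 1) * k) (by nlinarith) ?_
  have h3 := (QuotientGroup.eq (s := Subgroup.upperCentralSeries G j)).1 h2
  refine ⟨(u ^ k)⁻¹ * _, ⟨_, huV k hkN, _, hmem, rfl⟩, _, h3, ?_⟩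
  simp [mul_assoc]

end TopologicalGroup

/-! ### Left-invariant vector fields and one-parameter subgroups -/

section LieGroup

variable {E : Type*} [NormedAddCommGroup E] [NormedSpace ℝ E]
  {G : Type*} [Group G] [TopologicalSpace G] [ChartedSpace E G] [LieGroup 𝓘(ℝ, E) ∞ G]

theorem LieGroup.mdifferentiableAt_mul_left (g h : G) :
    MDifferentiableAt 𝓘(ℝ, E) 𝓘(ℝ, E) (fun x : G => g * x) h :=
  (contMDiff_mul_left (I := 𝓘(ℝ, E)) (n := ∞) (a := g)).mdifferentiableAt (by simp)

variable (E G) in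
theorem LieGroup.minSmoothness_three : LieGroup 𝓘(ℝ, E) (minSmoothness ℝ 3) G :=
  LieGroup.of_le (n := ∞) (by
    simp only [minSmoothness_of_isRCLikeNormedField]
    exact WithTop.coe_le_coe.2 (le_top (a := (3 : ℕ∞))))

theorem mfderiv_mul_left_mulInvariantVectorField (X : GroupLieAlgebra 𝓘(ℝ, E) G) (g h : G) :
    mfderiv 𝓘(ℝ, E) 𝓘(ℝ, E) (fun x : G => g * x) h (mulInvariantVectorField X h) =
      mulInvariantVectorField X (g * h) := by
  have e : (fun x : G => g * h * x) = (fun x => g * x) ∘ fun x => h * x := by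
    ext x; simp [mul_assoc]
  simp only [mulInvariantVectorField]
  rw [e, mfderiv_comp_of_eq (y := h) (I' := 𝓘(ℝ, E)) (LieGroup.mdifferentiableAt_mul_left g h)
    (LieGroup.mdifferentiableAt_mul_left h 1) (by simp)]
  change _ = mfderiv 𝓘(ℝ, E) 𝓘(ℝ, E) (fun x : G => g * x) (h * 1)
    (mfderiv 𝓘(ℝ, E) 𝓘(ℝ, E) (fun x : G => h * x) 1 X)
  rw [mul_one]

omit [LieGroup 𝓘(ℝ, E) ∞ G] in
theorem mulInvariantVectorField_one (X : GroupLieAlgebra 𝓘(ℝ, E) G) :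
    mulInvariantVectorField X (1 : G) = X := by
  have e : (fun x : G => 1 * x) = id := by ext x; simp
  simp only [mulInvariantVectorField]
  rw [e, mfderiv_id]
  rfl

theorem contMDiff_one_mulInvariantVectorField (X : GroupLieAlgebra 𝓘(ℝ, E) G) :
    ContMDiff 𝓘(ℝ, E) 𝓘(ℝ, E).tangent 1
      (fun g : G => (⟨g, mulInvariantVectorField X g⟩ : TangentBundle 𝓘(ℝ, E) G)) := by
  have := LieGroup.minSmoothness_three E G
  exact (contMDiff_mulInvariantVectorField X).of_le (by simp)

theorem IsMIntegralCurveOn.mul_left {X : GroupLieAlgebra 𝓘(ℝ, E) G} {γ : ℝ → G} {s : Set ℝ}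
    (hγ : IsMIntegralCurveOn γ (mulInvariantVectorField X) s) (g : G) :
    IsMIntegralCurveOn (fun t => g * γ t) (mulInvariantVectorField X) s := by
  intro t ht
  have h := (LieGroup.mdifferentiableAt_mul_left (E := E) g
    (γ t)).hasMFDerivAt.comp_hasMFDerivWithinAt t (hγ t ht)
  refine h.congr_mfderiv (ContinuousLinearMap.ext fun a : ℝ => ?_)
  change mfderiv 𝓘(ℝ, E) 𝓘(ℝ, E) (fun x : G => g * x) (γ t)
    (a • mulInvariantVectorField X (γ t)) = a • mulInvariantVectorField X (g * γ t)
  rw [map_smul, mfderiv_mul_left_mulInvariantVectorField]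

/-- The curve `c` in `G` has velocity `X` at time `0`. The tangent spaces of `G` are all modelled on
`E`, so that `X` can be taken in `E`; it is meant for curves with `c 0 = 1`. -/
def HasVelocityAtZero (c : ℝ → G) (X : E) : Prop :=
  HasMFDerivAt 𝓘(ℝ, ℝ) 𝓘(ℝ, E) c 0 (ContinuousLinearMap.toSpanSingleton ℝ X : ℝ →L[ℝ] E)

/-- A homomorphism from `ℝ` with velocity `X` at `0` is an integral curve of the left-invariant
vector field of `X`. -/
theorem HasVelocityAtZero.isMIntegralCurve {X : E} {c : ℝ → G}
    (hX : HasVelocityAtZero c X) (hc : ∀ s t, c (s + t) = c s * c t) :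
    IsMIntegralCurve c (mulInvariantVectorField (I := 𝓘(ℝ, E)) (G := G) X) := by
  intro t
  have h0 : c 0 = 1 := by simpa using hc 0 0
  have h1 : HasMFDerivAt 𝓘(ℝ, ℝ) 𝓘(ℝ, ℝ) (fun s : ℝ => s - t) t
      (ContinuousLinearMap.id ℝ ℝ) :=
    ((hasFDerivAt_id t).sub_const t).hasMFDerivAt
  have h2 : HasMFDerivAt 𝓘(ℝ, ℝ) 𝓘(ℝ, E) c (t - t)
      (ContinuousLinearMap.toSpanSingleton ℝ X : ℝ →L[ℝ] E) := by
    rw [sub_self]; exact hX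
  have h3 := (LieGroup.mdifferentiableAt_mul_left (E := E) (c t) (c (t - t))).hasMFDerivAt
  have h4 := h3.comp t (HasMFDerivAt.comp (f := fun s : ℝ => s - t) t h2 h1)
  have e : (fun x => c t * x) ∘ c ∘ (fun s : ℝ => s - t) = c := by
    ext s
    simp [← hc]
  rw [e] at h4
  refine h4.congr_mfderiv (ContinuousLinearMap.ext fun a : ℝ => ?_)
  change mfderiv 𝓘(ℝ, E) 𝓘(ℝ, E) (fun x : G => c t * x) (c (t - t)) (a • X) =
    a • mulInvariantVectorField (I := 𝓘(ℝ, E)) (G := G) X (c t)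
  rw [show c (t - t) = 1 by simpa using h0]
  exact map_smul (mfderiv 𝓘(ℝ, E) 𝓘(ℝ, E) (fun x : G => c t * x) 1) a X

omit [LieGroup 𝓘(ℝ, E) ∞ G] in
theorem IsMIntegralCurve.hasVelocityAtZero {X : E} {c : ℝ → G} (h0 : c 0 = 1)
    (hc : IsMIntegralCurve c (mulInvariantVectorField (I := 𝓘(ℝ, E)) (G := G) X)) :
    HasVelocityAtZero c X := by
  refine (hc 0).congr_mfderiv (ContinuousLinearMap.ext fun a : ℝ => ?_)
  change a • mulInvariantVectorField (I := 𝓘(ℝ, E)) (G := G) X (c 0) = a • X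
  rw [h0]
  exact congrArg (a • ·) (mulInvariantVectorField_one (G := G) X)

theorem HasVelocityAtZero.mul {X Y : E} {c d : ℝ → G} (hc : HasVelocityAtZero c X)
    (hd : HasVelocityAtZero d Y) (hc0 : c 0 = 1) (hd0 : d 0 = 1) :
    HasVelocityAtZero (fun t => c t * d t) (X + Y) := by
  have h1 : MDifferentiableAt (𝓘(ℝ, E).prod 𝓘(ℝ, E)) 𝓘(ℝ, E) (fun p : G × G => p.1 * p.2)
      (c 0, d 0) := (contMDiff_mul 𝓘(ℝ, E) ∞).mdifferentiableAt (by simp)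
  have h2 := HasMFDerivAt.comp (f := fun t => (c t, d t)) 0 h1.hasMFDerivAt
    (HasMFDerivAt.prodMk hc hd)
  refine h2.congr_mfderiv (ContinuousLinearMap.ext fun a : ℝ => ?_)
  change mfderiv (𝓘(ℝ, E).prod 𝓘(ℝ, E)) 𝓘(ℝ, E) (fun p : G × G => p.1 * p.2) (c 0, d 0)
    (a • X, a • Y) = a • (X + Y)
  have e1 : (fun x : G => x * (c 0, d 0).2) = id := by ext; simp [hd0]
  have e2 : (fun x : G => (c 0, d 0).1 * x) = id := by ext; simp [hc0]
  refine (mfderiv_prod_eq_add_apply h1).trans ?_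
  rw [e1, e2, mfderiv_id, mfderiv_id]
  exact (smul_add a X Y).symm

end LieGroup

/-! ### The exponential map -/

section LieExp

variable {E : Type*} [NormedAddCommGroup E] [NormedSpace ℝ E] [CompleteSpace E]
  {G : Type*} [Group G] [TopologicalSpace G] [ChartedSpace E G] [LieGroup 𝓘(ℝ, E) ∞ G]
  [T2Space G]

/-- Left-invariant vector fields are complete: by left translation, every integral curve exists for
the same uniform time. -/
theorem exists_isMIntegralCurve_mulInvariantVectorField (X : GroupLieAlgebra 𝓘(ℝ, E) G) :
    ∃ γ : ℝ → G, γ 0 = 1 ∧ IsMIntegralCurve γ (mulInvariantVectorField X) := by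
  have : IsManifold 𝓘(ℝ, E) 1 G := IsManifold.of_le (n := ∞) (by simp)
  have hv := contMDiff_one_mulInvariantVectorField (G := G) X
  obtain ⟨γ, hγ0, hγ⟩ := exists_isMIntegralCurveAt_of_contMDiffAt_boundaryless (x₀ := (1 : G)) 0
    hv.contMDiffAt
  obtain ⟨ε, hε, hγ⟩ := isMIntegralCurveAt_iff'.1 hγ
  rw [Real.ball_eq_Ioo, zero_sub, zero_add] at hγ
  exact exists_isMIntegralCurve_of_isMIntegralCurveOn hv hε
    (fun x => ⟨fun t => x * γ t, by simp [hγ0], hγ.mul_left x⟩) 1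

variable (G) in
/-- The exponential map of a Lie group `G` modelled on `E`: the value at time `1` of the integral
curve through `1` of a left-invariant vector field. The Lie algebra is the tangent space at
`1`, which as a type is `E`. -/
noncomputable def lieExp (X : E) : G :=
  (exists_isMIntegralCurve_mulInvariantVectorField (E := E) (G := G) X).choose 1

omit [CompleteSpace E] in
theorem IsMIntegralCurve.eq_of_apply_eq {X : GroupLieAlgebra 𝓘(ℝ, E) G} {γ δ : ℝ → G}
    (hγ : IsMIntegralCurve γ (mulInvariantVectorField X))
    (hδ : IsMIntegralCurve δ (mulInvariantVectorField X)) (t₀ : ℝ) (h : γ t₀ = δ t₀) : γ = δ := by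
  have : IsManifold 𝓘(ℝ, E) 1 G := IsManifold.of_le (n := ∞) (by simp)
  exact isMIntegralCurve_Ioo_eq_of_contMDiff_boundaryless (t₀ := t₀)
    (contMDiff_one_mulInvariantVectorField X) hγ hδ h

theorem IsMIntegralCurve.eq_lieExp {X : E} {c : ℝ → G} (h0 : c 0 = 1)
    (hc : IsMIntegralCurve c (mulInvariantVectorField (I := 𝓘(ℝ, E)) (G := G) X)) (t : ℝ) :
    c t = lieExp G (t • X) := by
  obtain ⟨h1, h2⟩ := (exists_isMIntegralCurve_mulInvariantVectorField (E := E) (G := G)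
    (t • X : E)).choose_spec
  have h3 := hc.comp_mul t
  have e : t • mulInvariantVectorField (I := 𝓘(ℝ, E)) (G := G) X =
      mulInvariantVectorField (I := 𝓘(ℝ, E)) (G := G) (t • X : E) :=
    (mulInvariantVectorField_smul t _).symm
  rw [e] at h3
  have h4 := h3.eq_of_apply_eq h2 0 (by rw [h1]; simp [h0])
  have h5 := congrFun h4 1
  rw [Function.comp_apply, one_mul] at h5
  exact h5

theorem isMIntegralCurve_lieExp (X : E) : IsMIntegralCurve (fun t : ℝ => lieExp G (t • X))
    (mulInvariantVectorField (I := 𝓘(ℝ, E)) (G := G) X) := by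
  obtain ⟨γ, h1, h2⟩ := exists_isMIntegralCurve_mulInvariantVectorField (E := E) (G := G) X
  convert h2 using 1
  ext t
  exact (h2.eq_lieExp h1 t).symm

@[simp] theorem lieExp_zero : lieExp G (0 : E) = 1 := by
  obtain ⟨γ, h1, h2⟩ := exists_isMIntegralCurve_mulInvariantVectorField (E := E) (G := G) (0 : E)
  rw [← h1, h2.eq_lieExp h1 0, zero_smul]

theorem lieExp_add_smul (s t : ℝ) (X : E) :
    lieExp G ((s + t) • X) = lieExp G (s • X) * lieExp G (t • X) := by
  have h := isMIntegralCurve_lieExp (G := G) X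
  have h1 : IsMIntegralCurve (fun t : ℝ => lieExp G (s • X) * lieExp G (t • X))
      (mulInvariantVectorField (I := 𝓘(ℝ, E)) (G := G) X) := by
    rw [isMIntegralCurve_iff_isMIntegralCurveOn] at h ⊢
    exact h.mul_left _
  have h2 := congrFun ((h.comp_add s).eq_of_apply_eq h1 0 (by simp)) t
  simpa [add_comm] using h2

theorem hasVelocityAtZero_lieExp (X : E) : HasVelocityAtZero (fun t : ℝ => lieExp G (t • X)) X :=
  (isMIntegralCurve_lieExp X).hasVelocityAtZero (by simp)

/-- A homomorphism from `ℝ` that is differentiable at `0` is a one-parameter subgroup. -/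
theorem HasVelocityAtZero.eq_lieExp {X : E} {c : ℝ → G} (hX : HasVelocityAtZero c X)
    (hc : ∀ s t, c (s + t) = c s * c t) (t : ℝ) : c t = lieExp G (t • X) :=
  (hX.isMIntegralCurve hc).eq_lieExp (by simpa using hc 0 0) t

theorem lieExp_neg (X : E) : lieExp G (-X) = (lieExp G X)⁻¹ := by
  rw [eq_inv_iff_mul_eq_one]
  have := lieExp_add_smul (G := G) (-1) 1 X
  simpa using this.symm

theorem lieExp_natCast_smul (n : ℕ) (X : E) : lieExp G ((n : ℝ) • X) = lieExp G X ^ n := by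
  induction n with
  | zero => simp
  | succ n ih => rw [Nat.cast_succ, lieExp_add_smul, ih, one_smul, pow_succ]

/-- A one-parameter subgroup determines its generator. -/
theorem eq_of_forall_lieExp_smul_eq (X Y : E)
    (h : ∀ t : ℝ, lieExp G (t • X) = lieExp G (t • Y)) : X = Y := by
  have h1 := hasVelocityAtZero_lieExp (G := G) X
  have h2 := hasVelocityAtZero_lieExp (G := G) Y
  rw [funext h] at h1
  have h3 := hasMFDerivAt_unique h1 h2
  have h4 := congrArg (fun L : ℝ →L[ℝ] E => L 1) h3
  simpa using h4

theorem continuous_lieExp_smul (X : E) : Continuous fun t : ℝ => lieExp G (t • X) :=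
  (isMIntegralCurve_lieExp X).continuous

/-- A smooth endomorphism trivial on all one-parameter subgroups is trivial: its derivative vanishes
at `1`, hence everywhere by left translation, so that its kernel is open. -/
theorem eq_one_of_lieExp_eq_one [ConnectedSpace G] {f : G →* G}
    (hf : ContMDiff 𝓘(ℝ, E) 𝓘(ℝ, E) ∞ f) (h : ∀ X : E, f (lieExp G X) = 1) (g : G) : f g = 1 := by
  have hfd : ∀ g, MDifferentiableAt 𝓘(ℝ, E) 𝓘(ℝ, E) f g := fun g => hf.mdifferentiableAt (by simp)
  have h1 : mfderiv 𝓘(ℝ, E) 𝓘(ℝ, E) f 1 = 0 := by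
    refine ContinuousLinearMap.ext fun X : E => ?_
    have hX := hasVelocityAtZero_lieExp (G := G) X
    have h2 : HasMFDerivAt 𝓘(ℝ, E) 𝓘(ℝ, E) f (lieExp G ((0 : ℝ) • X))
        (mfderiv 𝓘(ℝ, E) 𝓘(ℝ, E) f (lieExp G ((0 : ℝ) • X))) := (hfd _).hasMFDerivAt
    have h3 := HasMFDerivAt.comp (f := fun t : ℝ => lieExp G (t • X)) 0 h2 hX
    have e : f ∘ (fun t : ℝ => lieExp G (t • X)) = fun _ => 1 := by ext t; simp [h]
    rw [e] at h3
    have h4 := hasMFDerivAt_unique h3 (hasMFDerivAt_const (1 : G) (0 : ℝ))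
    have h5 : mfderiv 𝓘(ℝ, E) 𝓘(ℝ, E) f (lieExp G ((0 : ℝ) • X)) ((1 : ℝ) • X) = (0 : E) :=
      congrArg (fun L : ℝ →L[ℝ] E => L 1) h4
    rw [one_smul, zero_smul, lieExp_zero] at h5
    exact h5
  have h2 : ∀ g, mfderiv 𝓘(ℝ, E) 𝓘(ℝ, E) f g = 0 := by
    intro g
    have e : f = (fun x => f g * x) ∘ f ∘ fun x => g⁻¹ * x := by ext x; simp
    have h3 : HasMFDerivAt 𝓘(ℝ, E) 𝓘(ℝ, E) f (g⁻¹ * g) (0 : E →L[ℝ] E) := by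
      rw [inv_mul_cancel]
      exact (hfd 1).hasMFDerivAt.congr_mfderiv h1
    have h4 := (LieGroup.mdifferentiableAt_mul_left (E := E) (f g) (f (g⁻¹ * g))).hasMFDerivAt.comp
      g (h3.comp g (LieGroup.mdifferentiableAt_mul_left (E := E) g⁻¹ g).hasMFDerivAt)
    have h5 : mfderiv 𝓘(ℝ, E) 𝓘(ℝ, E) ((fun x => f g * x) ∘ f ∘ fun x => g⁻¹ * x) g = 0 := by
      rw [h4.mfderiv]
      refine ContinuousLinearMap.ext fun X : E => ?_
      exact map_zero (mfderiv 𝓘(ℝ, E) 𝓘(ℝ, E) (fun x => f g * x) (f (g⁻¹ * g)))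
    rw [← e] at h5
    exact h5
  have := topologicalGroup_of_lieGroup 𝓘(ℝ, E) ∞ (G := G)
  have : IsManifold 𝓘(ℝ, E) 1 G := IsManifold.of_le (n := ∞) (by simp)
  have hker : f.ker = ⊤ := by
    apply Subgroup.eq_top_of_mem_nhds_one
    set φ := extChartAt 𝓘(ℝ, E) (1 : G) with hφ
    have hsrc : ∀ᶠ x in 𝓝 (φ 1), x ∈ φ.target ∧ f (φ.symm x) ∈ (chartAt E (1 : G)).source := by
      refine Filter.Eventually.and (extChartAt_target_mem_nhds 1) ?_
      have hc : ContinuousAt (fun x => f (φ.symm x)) (φ 1) :=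
        hf.continuous.continuousAt.comp (continuousAt_extChartAt_symm 1)
      refine hc.preimage_mem_nhds ?_
      rw [extChartAt_to_inv, map_one]
      exact chart_source_mem_nhds E 1
    obtain ⟨r, hr, hball⟩ := Metric.eventually_nhds_iff_ball.1 hsrc
    have hder : ∀ x ∈ Metric.ball (φ 1) r,
        HasFDerivAt (fun x => φ (f (φ.symm x))) (0 : E →L[ℝ] E) x := by
      intro x hx
      have h3 := (mdifferentiableAt_extChartAt (I := 𝓘(ℝ, E)) (hball x hx).2).hasMFDerivAt
      have h4 : HasMFDerivAt 𝓘(ℝ, E) 𝓘(ℝ, E) f (φ.symm x) (0 : E →L[ℝ] E) :=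
        (hfd _).hasMFDerivAt.congr_mfderiv (h2 _)
      have h5 : MDifferentiableAt 𝓘(ℝ, E) 𝓘(ℝ, E) φ.symm x := by
        have := mdifferentiableWithinAt_extChartAt_symm (I := 𝓘(ℝ, E)) (hball x hx).1
        rwa [modelWithCornersSelf_coe, Set.range_id, mdifferentiableWithinAt_univ] at this
      refine HasMFDerivAt.hasFDerivAt ((h3.comp x (h4.comp x h5.hasMFDerivAt)).congr_mfderiv ?_)
      refine ContinuousLinearMap.ext fun X : E => ?_
      exact map_zero (mfderiv 𝓘(ℝ, E) 𝓘(ℝ, E) (extChartAt 𝓘(ℝ, E) (1 : G)) (f (φ.symm x)))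
    have hconst : ∀ x ∈ Metric.ball (φ 1) r, φ (f (φ.symm x)) = φ (f (φ.symm (φ 1))) := by
      intro x hx
      exact Metric.isOpen_ball.is_const_of_fderiv_eq_zero (𝕜 := ℝ)
        (convex_ball (φ 1) r).isPreconnected
        (fun x hx => (hder x hx).differentiableAt.differentiableWithinAt)
        (fun x hx => (hder x hx).fderiv) hx (Metric.mem_ball_self hr)
    filter_upwards [extChartAt_source_mem_nhds (I := 𝓘(ℝ, E)) (1 : G),
      (continuousAt_extChartAt (I := 𝓘(ℝ, E)) (1 : G)).preimage_mem_nhds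
        (Metric.ball_mem_nhds _ hr)] with x hx hxr
    have h3 := hconst (φ x) hxr
    rw [φ.left_inv hx, extChartAt_to_inv, map_one] at h3
    have h4 : f x ∈ φ.source := by
      have := (hball _ hxr).2
      rw [φ.left_inv hx] at this
      rwa [extChartAt_source]
    exact φ.injOn h4 (mem_extChartAt_source (I := 𝓘(ℝ, E)) (1 : G)) h3
  have : g ∈ f.ker := by rw [hker]; trivial
  exact this

/-- One-parameter subgroups are `C^1`: in a chart, the derivative at `t` is the value of a
continuous vector field at the point reached at time `t`. -/
theorem contMDiff_lieExp_smul (X : E) :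
    ContMDiff 𝓘(ℝ, ℝ) 𝓘(ℝ, E) 1 (fun t : ℝ => lieExp G (t • X)) := by
  have : IsManifold 𝓘(ℝ, E) 1 G := IsManifold.of_le (n := ∞) (by simp)
  set γ := fun t : ℝ => lieExp G (t • X) with hγ
  have hc : Continuous γ := continuous_lieExp_smul X
  intro t₀
  have h1 := ((isMIntegralCurve_lieExp (G := G) X).isMIntegralCurveAt t₀).eventually_hasDerivAt
  rw [contMDiffAt_iff]
  refine ⟨hc.continuousAt, ?_⟩
  simp only [mfld_simps, contDiffWithinAt_univ]
  rw [show (1 : WithTop ℕ∞) = ((0 : ℕ) : WithTop ℕ∞) + 1 by simp, contDiffAt_succ_iff_hasFDerivAt]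
  let e := trivializationAt E (TangentSpace 𝓘(ℝ, E)) (γ t₀)
  let D : ℝ → E := fun t => (e ⟨γ t, mulInvariantVectorField (I := 𝓘(ℝ, E)) (G := G) X (γ t)⟩).2
  have hD : ContinuousOn D (γ ⁻¹' e.baseSet) := by
    refine continuous_snd.comp_continuousOn (e.continuousOn.comp
      ((contMDiff_one_mulInvariantVectorField (G := G) X).continuous.comp hc).continuousOn ?_)
    intro t ht
    exact e.mem_source.2 ht
  obtain ⟨s, hs, hs'⟩ := h1.exists_mem
  have hbase : γ ⁻¹' e.baseSet ∈ 𝓝 t₀ := hc.continuousAt.preimage_mem_nhds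
    (e.open_baseSet.mem_nhds (FiberBundle.mem_baseSet_trivializationAt' (γ t₀)))
  refine ⟨fun t => ContinuousLinearMap.toSpanSingleton ℝ (D t), ⟨s ∩ γ ⁻¹' e.baseSet,
    Filter.inter_mem hs hbase, fun t ht => (hs' t ht.1).hasFDerivAt⟩, ?_⟩
  rw [Nat.cast_zero, contDiffAt_zero]
  exact ⟨γ ⁻¹' e.baseSet, hbase,
    (ContinuousLinearMap.toSpanSingletonCLE (𝕜 := ℝ) (E := E)).continuous.comp_continuousOn hD⟩

end LieExp

/-! ### Escape modulo the center -/

section Commutator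

variable {G : Type*} [Group G]

theorem commutatorElement_mul_right_of_central {x g h : G} (hh : ∀ k, Commute ⁅x, h⁆ k) :
    ⁅x, g * h⁆ = ⁅x, g⁆ * ⁅x, h⁆ := by
  have e : ⁅x, g * h⁆ = ⁅x, g⁆ * (g * ⁅x, h⁆ * g⁻¹) := by
    simp only [commutatorElement_def]; group
  rw [e, ← (hh g).eq, mul_inv_cancel_right]

theorem commutatorElement_mul_left_of_central {x y g : G} (hh : ∀ k, Commute ⁅y, g⁆ k) :
    ⁅x * y, g⁆ = ⁅x, g⁆ * ⁅y, g⁆ := by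
  have e : ⁅x * y, g⁆ = x * ⁅y, g⁆ * x⁻¹ * ⁅x, g⁆ := by
    simp only [commutatorElement_def]; group
  rw [e, ← (hh x).eq, mul_inv_cancel_right, (hh _).eq]

theorem commutatorElement_pow_left_of_central {x g : G} (hh : ∀ k, Commute ⁅x, g⁆ k) (n : ℕ) :
    ⁅x ^ n, g⁆ = ⁅x, g⁆ ^ n := by
  induction n with
  | zero => simp
  | succ n ih => rw [pow_succ, commutatorElement_mul_left_of_central hh, ih, pow_succ]

end Commutator

/-- Modulo the center, the powers of an element `z` of `Z_2 \ Z_1` escape from every compact set.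
The map `g ↦ ⁅z, g⁆` is a nontrivial homomorphism into the center. If `zⁿ = kζ` with `k` in
a compact set and `ζ` central, then `⁅z, exp X⁆ = ⁅zⁿ, exp (X / n)⁆ = ⁅k, exp (X / n)⁆`,
which is close to `1` for large `n`, uniformly in `k`. -/
theorem exists_forall_pow_notMem_mul_center
    (E : Type*) [NormedAddCommGroup E] [NormedSpace ℝ E] [CompleteSpace E]
    {G : Type*} [Group G] [TopologicalSpace G] [ChartedSpace E G] [LieGroup 𝓘(ℝ, E) ∞ G]
    [T2Space G] [ConnectedSpace G] {z : G}
    (hz2 : z ∈ Subgroup.upperCentralSeries G 2) (hz1 : z ∉ Subgroup.upperCentralSeries G 1)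
    {K : Set G} (hK : IsCompact K) :
    ∃ n₀ : ℕ, ∀ n ≥ n₀, z ^ n ∉ K * (Subgroup.upperCentralSeries G 1 : Set G) := by
  have := topologicalGroup_of_lieGroup 𝓘(ℝ, E) ∞ (G := G)
  have hcen : ∀ g k : G, Commute ⁅z, g⁆ k := by
    intro g k
    have := Subgroup.mem_upperCentralSeries_succ_iff.1 hz2 g
    rw [Subgroup.upperCentralSeries_one, Subgroup.mem_center_iff] at this
    exact (this k).symm
  let f : G →* G :=
    { toFun := fun g => ⁅z, g⁆
      map_one' := by simp
      map_mul' := fun g h => commutatorElement_mul_right_of_central (hcen h) }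
  have hf : ContMDiff 𝓘(ℝ, E) 𝓘(ℝ, E) ∞ f := by
    change ContMDiff 𝓘(ℝ, E) 𝓘(ℝ, E) ∞ fun g => z * g * z⁻¹ * g⁻¹
    exact ((contMDiff_const.mul contMDiff_id).mul contMDiff_const).mul contMDiff_id.inv
  obtain ⟨X, hX⟩ : ∃ X : E, ⁅z, lieExp G X⁆ ≠ 1 := by
    by_contra! hcon
    apply hz1
    rw [Subgroup.upperCentralSeries_one, Subgroup.mem_center_iff]
    intro g
    exact (commutatorElement_eq_one_iff_commute.1
      (eq_one_of_lieExp_eq_one hf hcon g)).symm.eq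
  have h1 : ∀ᶠ g in 𝓝 (1 : G), ∀ k ∈ K, ⁅k, g⁆ ∈ ({⁅z, lieExp G X⁆}ᶜ : Set G) :=
    eventually_forall_mem_of_isCompact hK (isOpen_compl_singleton.mem_nhds hX.symm)
      (f := fun g k => ⁅k, g⁆)
      (by
        change Continuous fun p : G × G => p.2 * p.1 * p.2⁻¹ * p.1⁻¹
        fun_prop) (by simp)
  have h2 : Filter.Tendsto (fun n : ℕ => lieExp G ((n : ℝ)⁻¹ • X)) Filter.atTop (𝓝 1) := by
    have := (continuous_lieExp_smul (G := G) X).tendsto 0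
    rw [zero_smul, lieExp_zero] at this
    exact this.comp tendsto_inv_atTop_nhds_zero_nat
  obtain ⟨n₀, hn₀⟩ := Filter.eventually_atTop.1 (h2.eventually h1)
  refine ⟨n₀ + 1, fun n hn hmem => ?_⟩
  obtain ⟨k, hk, c, hc, hkc⟩ := hmem
  refine hn₀ n (by omega) k hk ?_
  have hc' : ∀ g : G, ⁅c, g⁆ = 1 := by
    intro g
    rw [Subgroup.upperCentralSeries_one] at hc
    exact commutatorElement_eq_one_iff_commute.2 ((Subgroup.mem_center_iff.1 hc g).symm)
  have hn0 : (n : ℝ) ≠ 0 := by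
    have : n ≠ 0 := by omega
    exact_mod_cast this
  set g := lieExp G ((n : ℝ)⁻¹ • X) with hg
  have h3 : lieExp G X = g ^ n := by
    rw [hg, ← lieExp_natCast_smul, smul_smul, mul_inv_cancel₀ hn0, one_smul]
  have h4 : ⁅z, g ^ n⁆ = ⁅z, g⁆ ^ n := map_pow f g n
  have h5 : ⁅k, g⁆ = ⁅z ^ n, g⁆ := by
    rw [← show k * c = z ^ n from hkc, commutatorElement_mul_left_of_central, hc', mul_one]
    intro j
    rw [hc']
    exact Commute.one_left j
  rw [Set.mem_singleton_iff, h5, commutatorElement_pow_left_of_central (hcen g), h3, h4]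

/-! ### The bracket and the exponential map in nilpotency class two -/

section ClassTwo

variable {E : Type*} [NormedAddCommGroup E] [NormedSpace ℝ E] [CompleteSpace E]
  {G : Type*} [Group G] [TopologicalSpace G] [ChartedSpace E G] [LieGroup 𝓘(ℝ, E) ∞ G]
  [T2Space G]

theorem exists_eq_lieExp_smul {c : ℝ → G} (hc : ∀ s t, c (s + t) = c s * c t)
    (hd : MDifferentiableAt 𝓘(ℝ, ℝ) 𝓘(ℝ, E) c 0) : ∃ Z : E, ∀ t : ℝ, c t = lieExp G (t • Z) := by
  let L : ℝ →L[ℝ] E := mfderiv 𝓘(ℝ, ℝ) 𝓘(ℝ, E) c 0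
  refine ⟨L 1, HasVelocityAtZero.eq_lieExp ?_ hc⟩
  have : L = ContinuousLinearMap.toSpanSingleton ℝ (L 1) := by ext; simp
  exact hd.hasMFDerivAt.congr_mfderiv this

theorem lieExp_add_of_commute {X Y : E}
    (h : ∀ s t : ℝ, Commute (lieExp G (s • X)) (lieExp G (t • Y))) :
    lieExp G (X + Y) = lieExp G X * lieExp G Y := by
  have h1 := ((hasVelocityAtZero_lieExp (G := G) X).mul (hasVelocityAtZero_lieExp Y) (by simp)
    (by simp)).eq_lieExp (fun s t => by
      rw [lieExp_add_smul, lieExp_add_smul]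
      calc _ = lieExp G (s • X) * (lieExp G (t • X) * lieExp G (s • Y)) * lieExp G (t • Y) := by
            group
        _ = _ := by rw [(h t s).eq]; group) 1
  simpa using h1.symm

omit [CompleteSpace E] [T2Space G] in
theorem mdifferentiableAt_commutatorElement {c : ℝ → G} {t : ℝ}
    (hc : MDifferentiableAt 𝓘(ℝ, ℝ) 𝓘(ℝ, E) c t) (g : G) :
    MDifferentiableAt 𝓘(ℝ, ℝ) 𝓘(ℝ, E) (fun t => ⁅c t, g⁆) t := by
  have h1 : ContMDiff 𝓘(ℝ, E) 𝓘(ℝ, E) ∞ (fun x : G => x * g * x⁻¹ * g⁻¹) :=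
    ((contMDiff_id.mul contMDiff_const).mul contMDiff_id.inv).mul contMDiff_const
  exact (h1.mdifferentiableAt (x := c t) (by simp)).comp t hc

theorem exists_commutatorElement_lieExp_eq (hcl : ∀ x y k : G, Commute ⁅x, y⁆ k) (X Y : E) :
    ∃ Z : E, ∀ r : ℝ, ⁅lieExp G (r • X), lieExp G Y⁆ = lieExp G (r • Z) := by
  refine exists_eq_lieExp_smul (fun s t => ?_) ?_
  · rw [lieExp_add_smul, commutatorElement_mul_left_of_central (hcl _ _)]
  · exact mdifferentiableAt_commutatorElement
      (hasVelocityAtZero_lieExp X).mdifferentiableAt _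

/-- In a Lie group of nilpotency class two the commutator of one-parameter subgroups defines a
bilinear bracket on the Lie algebra, and the exponential map satisfies the
Baker–Campbell–Hausdorff formula `exp X * exp Y = exp (X + Y + ⁅X, Y⁆ / 2)`. -/
theorem exists_bilinear_lieExp_mul (hcl : ∀ x y k : G, Commute ⁅x, y⁆ k) :
    ∃ b : E →ₗ[ℝ] E →ₗ[ℝ] E,
      (∀ X Y, ⁅lieExp G X, lieExp G Y⁆ = lieExp G (b X Y)) ∧
      (∀ X Y, lieExp G X * lieExp G Y = lieExp G (X + Y + (1 / 2 : ℝ) • b X Y)) ∧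
      (∀ X, b X X = 0) ∧ (∀ X Y Z, b (b X Y) Z = 0) := by
  choose b hb using exists_commutatorElement_lieExp_eq (E := E) hcl
  have hbc : ∀ X Y (r : ℝ) (k : G), Commute (lieExp G (r • b X Y)) k := fun X Y r k => by
    rw [← hb]; exact hcl _ _ _
  have badd : ∀ X Y X' Y', ∀ r : ℝ, lieExp G (r • (b X Y + b X' Y')) =
      lieExp G (r • b X Y) * lieExp G (r • b X' Y') := fun X Y X' Y' r => by
    rw [smul_add]
    exact lieExp_add_of_commute fun s t => by rw [smul_smul]; exact hbc _ _ _ _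
  -- homogeneity in the second variable: additivity of `s ↦ b X (s • Y)` gives it for rational
  -- `s`, and continuity of the commutator in `s` for all `s`
  have hb2 : ∀ (r s : ℝ) X Y,
      ⁅lieExp G (r • X), lieExp G (s • Y)⁆ = lieExp G ((r * s) • b X Y) := by
    intro r s X Y
    let g : ℝ →+ E := AddMonoidHom.mk' (fun s => b X (s • Y)) fun s s' =>
      eq_of_forall_lieExp_smul_eq (G := G) _ _ fun t => by
        rw [badd, ← hb, ← hb, ← hb, lieExp_add_smul,
          commutatorElement_mul_right_of_central (hcl _ _)]
    have hq : ∀ q : ℚ, b X ((q : ℝ) • Y) = (q : ℝ) • b X Y := by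
      intro q
      have := map_ratCast_smul g ℝ ℝ q 1
      simpa [g] using this
    have hc1 : Continuous fun s : ℝ => ⁅lieExp G (r • X), lieExp G (s • Y)⁆ := by
      have := topologicalGroup_of_lieGroup 𝓘(ℝ, E) ∞ (G := G)
      have h := continuous_lieExp_smul (G := G) Y
      simp only [commutatorElement_def]
      fun_prop
    have hc2 : Continuous fun s : ℝ => lieExp G ((r * s) • b X Y) :=
      (continuous_lieExp_smul (G := G) (b X Y)).comp (continuous_const_mul r)
    refine congrFun (Rat.denseRange_cast.equalizer hc1 hc2 ?_) s
    ext q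
    simp [hb, hq, smul_smul]
  have hsmul : ∀ (r : ℝ) X Y, b (r • X) Y = r • b X Y := fun r X Y =>
    eq_of_forall_lieExp_smul_eq (G := G) _ _ fun t => by rw [← hb, smul_smul, smul_smul, ← hb]
  have hneg : ∀ X Y, b Y X = - b X Y := fun X Y =>
    eq_of_forall_lieExp_smul_eq (G := G) _ _ fun t => by
      have := hb2 1 t X Y
      rw [one_mul, one_smul] at this
      rw [← hb, smul_neg, lieExp_neg, ← this, commutatorElement_inv]
  have hmul : ∀ X Y, lieExp G (X + Y) =
      lieExp G X * lieExp G Y * lieExp G (-(1 / 2 : ℝ) • b X Y) := by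
    intro X Y
    -- `t ↦ exp (t • X) * exp (t • Y) * exp (-(t² / 2) • b X Y)` is a homomorphism with velocity
    -- `X + Y`: the last factor absorbs the commutator and has velocity `0`
    have hd : HasVelocityAtZero (fun t : ℝ => lieExp G ((-(t ^ 2) / 2) • b X Y)) (0 : E) := by
      have h1 : HasDerivAt (fun t : ℝ => -(t ^ 2) / 2) 0 0 := by
        have := ((hasDerivAt_pow 2 (0 : ℝ)).neg).div_const 2
        simpa using this
      have h2 : HasMFDerivAt 𝓘(ℝ, ℝ) 𝓘(ℝ, E) (fun t : ℝ => lieExp G (t • b X Y)) (-(0 ^ 2) / 2)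
          (ContinuousLinearMap.toSpanSingleton ℝ (b X Y) : ℝ →L[ℝ] E) := by
        rw [show (-(0 ^ 2) / 2 : ℝ) = 0 by norm_num]
        exact hasVelocityAtZero_lieExp (G := G) (b X Y)
      refine (HasMFDerivAt.comp (f := fun t : ℝ => -(t ^ 2) / 2) 0 h2
        h1.hasFDerivAt.hasMFDerivAt).congr_mfderiv ?_
      refine ContinuousLinearMap.ext fun a : ℝ => ?_
      change (a • (0 : ℝ)) • b X Y = a • (0 : E)
      simp
    have h1 := (((hasVelocityAtZero_lieExp (G := G) X).mul (hasVelocityAtZero_lieExp Y) (by simp)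
      (by simp)).mul hd (by simp) (by simp)).eq_lieExp (fun s t => by
        have e1 : lieExp G (t • X) * lieExp G (s • Y) =
            lieExp G ((t * s) • b X Y) * (lieExp G (s • Y) * lieExp G (t • X)) := by
          rw [← hb2, commutatorElement_def]; group
        have e2 : -(s + t) ^ 2 / 2 = -(t * s) + (-s ^ 2 / 2 + -t ^ 2 / 2) := by ring
        rw [lieExp_add_smul, lieExp_add_smul, e2, lieExp_add_smul, lieExp_add_smul, neg_smul,
          lieExp_neg]
        generalize ht : lieExp G ((t * s) • b X Y) = w at e1
        have hw : ∀ k, Commute w k := fun k => ht ▸ hbc _ _ _ k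
        generalize hp : lieExp G ((-s ^ 2 / 2) • b X Y) = p
        have hp' : ∀ k, Commute p k := fun k => hp ▸ hbc _ _ _ k
        generalize lieExp G ((-t ^ 2 / 2) • b X Y) = q
        calc _ = lieExp G (s • X) * (lieExp G (t • X) * lieExp G (s • Y)) * lieExp G (t • Y) *
              (w⁻¹ * (p * q)) := by group
          _ = lieExp G (s • X) * (w * (lieExp G (s • Y) * lieExp G (t • X) * lieExp G (t • Y) *
              w⁻¹)) * (p * q) := by rw [e1]; group
          _ = lieExp G (s • X) * lieExp G (s • Y) *
              (lieExp G (t • X) * lieExp G (t • Y) * p) * q := by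
            rw [(hw _).eq]; group
          _ = _ := by rw [← (hp' _).eq]; group) 1
    simpa [neg_div] using h1.symm
  have haddl : ∀ X X' Y, b (X + X') Y = b X Y + b X' Y := fun X X' Y =>
    eq_of_forall_lieExp_smul_eq (G := G) _ _ fun t => by
      have hw : ∀ k, Commute (lieExp G (-(1 / 2 : ℝ) • b (t • X) (t • X'))) k := hbc _ _ _
      rw [badd, ← hb, ← hb, ← hb, smul_add, hmul, ← (hw _).eq,
        commutatorElement_mul_left_of_central (hcl _ _),
        commutatorElement_eq_one_iff_commute.2 (hw _), one_mul,
        commutatorElement_mul_left_of_central (hcl _ _)]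
  have hbb : ∀ X Y Z, b (b X Y) Z = 0 := fun X Y Z =>
    eq_of_forall_lieExp_smul_eq (G := G) _ _ fun t => by
      rw [← hb, smul_zero, lieExp_zero, commutatorElement_eq_one_iff_commute]
      exact hbc _ _ _ _
  refine ⟨LinearMap.mk₂ ℝ b haddl hsmul (fun X Y Y' => ?_) (fun r X Y => ?_), ?_, ?_, ?_, hbb⟩
  · rw [hneg, haddl, hneg X, hneg X]; simp [add_comm]
  · rw [hneg, hsmul, hneg X]; simp
  · intro X Y
    simpa using hb X Y 1
  · intro X Y
    rw [LinearMap.mk₂_apply, lieExp_add_of_commute, hmul, neg_smul, lieExp_neg,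
      inv_mul_cancel_right]
    intro s t
    rw [smul_smul]
    exact (hbc _ _ _ _).symm
  · intro X
    refine eq_of_forall_lieExp_smul_eq (G := G) _ _ fun t => ?_
    rw [LinearMap.mk₂_apply, ← hb, smul_zero, lieExp_zero, commutatorElement_eq_one_iff_commute]
    have h1 := lieExp_add_smul (G := G) t 1 X
    have h2 := lieExp_add_smul (G := G) 1 t X
    rw [one_smul] at h1 h2
    rw [Commute, SemiconjBy, ← h1, ← h2, add_comm]

end ClassTwo

/-! ### The exponential covering -/

section Covering

variable {E : Type*} [NormedAddCommGroup E] [NormedSpace ℝ E] [FiniteDimensional ℝ E]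
  {G : Type*} [Group G] [TopologicalSpace G] [ChartedSpace E G] [LieGroup 𝓘(ℝ, E) ∞ G]
  [T2Space G]

/-- The exponential map of a Lie group of nilpotency class two is `C^1`: by the
Baker–Campbell–Hausdorff formula, `exp (v + t • Y)` is a product of `exp v`, `exp (t • Y)` and
a commutator of such elements, so that one may add one basis vector at a time. -/
theorem contMDiff_lieExp (hcl : ∀ x y k : G, Commute ⁅x, y⁆ k) :
    ContMDiff 𝓘(ℝ, E) 𝓘(ℝ, E) 1 (lieExp G : E → G) := by
  have : LieGroup 𝓘(ℝ, E) 1 G := LieGroup.of_le (n := ∞) (by simp)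
  obtain ⟨b, hb1, hb2, hb3, hb4⟩ := exists_bilinear_lieExp_mul (E := E) hcl
  have hadd : ∀ X Y : E, lieExp G (X + Y) =
      lieExp G X * lieExp G Y * (⁅lieExp G X, lieExp G ((1 / 2 : ℝ) • Y)⁆)⁻¹ := by
    intro X Y
    rw [hb1, ← lieExp_neg, hb2, hb2]
    have e : b (X + Y + (1 / 2 : ℝ) • b X Y) (-b X ((1 / 2 : ℝ) • Y)) = 0 := by
      have halt : b.IsAlt := hb3
      rw [map_neg, ← halt.neg, hb4, neg_zero, neg_zero]
    rw [e]
    simp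
  let B := Module.finBasis ℝ E
  have hs : ∀ s : Finset (Fin (Module.finrank ℝ E)), ContMDiff 𝓘(ℝ, E) 𝓘(ℝ, E) 1
      (fun x : E => lieExp G (∑ i ∈ s, B.repr x i • B i)) := by
    intro s
    induction s using Finset.induction_on with
    | empty => simpa using contMDiff_const
    | insert i s his ih =>
      have hcoord : ContMDiff 𝓘(ℝ, E) 𝓘(ℝ, ℝ) 1 fun x : E => B.repr x i := by
        have : ContDiff ℝ 1 fun x : E => LinearMap.toContinuousLinearMap (B.coord i) x :=
          ContinuousLinearMap.contDiff _
        exact this.contMDiff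
      have h1 : ContMDiff 𝓘(ℝ, E) 𝓘(ℝ, E) 1 fun x : E => lieExp G (B.repr x i • B i) :=
        (contMDiff_lieExp_smul (B i)).comp hcoord
      have h2 : ContMDiff 𝓘(ℝ, E) 𝓘(ℝ, E) 1
          fun x : E => lieExp G ((1 / 2 : ℝ) • B.repr x i • B i) := by
        have := (contMDiff_lieExp_smul (G := G) ((1 / 2 : ℝ) • B i)).comp hcoord
        convert! this using 2 with x
        rw [smul_comm]
        rfl
      have h3 := (ih.mul h1).mul (((ih.mul h2).mul ih.inv).mul h2.inv).inv
      convert! h3 using 2 with x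
      rw [Finset.sum_insert his, add_comm, hadd]
      rfl
  simpa [B.sum_repr] using hs Finset.univ

/-- The exponential map is a local homeomorphism at `0`, by the inverse function theorem: its
derivative at `0` is the identity, as one sees on lines. -/
theorem map_nhds_zero_lieExp_and_exists_injOn (hcl : ∀ x y k : G, Commute ⁅x, y⁆ k) :
    Filter.map (lieExp G : E → G) (𝓝 0) = 𝓝 1 ∧
      ∃ U ∈ 𝓝 (0 : E), Set.InjOn (lieExp G : E → G) U := by
  have : IsManifold 𝓘(ℝ, E) 1 G := IsManifold.of_le (n := ∞) (by simp)
  have h1 : ContMDiffAt 𝓘(ℝ, E) 𝓘(ℝ, E) 1 (lieExp G : E → G) 0 := (contMDiff_lieExp hcl) 0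
  let φ := extChartAt 𝓘(ℝ, E) (lieExp G (0 : E))
  have h2 : ContDiffAt ℝ 1 (fun x : E => φ (lieExp G x)) 0 := by
    have := (contMDiffAt_iff.1 h1).2
    simp only [mfld_simps, contDiffWithinAt_univ] at this
    exact this
  have h3 : HasMFDerivAt 𝓘(ℝ, E) 𝓘(ℝ, E) (lieExp G : E → G) 0 (ContinuousLinearMap.id ℝ E) := by
    have hd := (h1.mdifferentiableAt one_ne_zero).hasMFDerivAt
    refine hd.congr_mfderiv (ContinuousLinearMap.ext fun X : E => ?_)
    have hline : HasMFDerivAt 𝓘(ℝ, ℝ) 𝓘(ℝ, E) (fun t : ℝ => t • X) 0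
        (ContinuousLinearMap.toSpanSingleton ℝ X) :=
      (ContinuousLinearMap.toSpanSingleton ℝ X).hasFDerivAt.hasMFDerivAt
    have hd' : HasMFDerivAt 𝓘(ℝ, E) 𝓘(ℝ, E) (lieExp G : E → G) ((0 : ℝ) • X)
        (mfderiv 𝓘(ℝ, E) 𝓘(ℝ, E) (lieExp G : E → G) 0 : E →L[ℝ] E) := by
      rw [zero_smul]
      exact hd
    have hcomp := HasMFDerivAt.comp (f := fun t : ℝ => t • X) 0 hd' hline
    have heq := hasMFDerivAt_unique hcomp (hasVelocityAtZero_lieExp (G := G) X)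
    have happ : (mfderiv 𝓘(ℝ, E) 𝓘(ℝ, E) (lieExp G : E → G) 0 : E →L[ℝ] E) ((1 : ℝ) • X) =
        (1 : ℝ) • X := congrArg (fun L : ℝ →L[ℝ] E => L 1) heq
    rw [one_smul] at happ
    exact happ
  have h4 : HasFDerivAt (fun x : E => φ (lieExp G x)) (ContinuousLinearMap.id ℝ E) 0 := by
    have := h3.2
    simp only [mfld_simps] at this
    exact hasFDerivWithinAt_univ.1 this
  have h5 : HasStrictFDerivAt (fun x : E => φ (lieExp G x))
      ((ContinuousLinearEquiv.refl ℝ E : E ≃L[ℝ] E) : E →L[ℝ] E) 0 :=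
    h2.hasStrictFDerivAt' h4 one_ne_zero
  have hsrc : ∀ᶠ x in 𝓝 (0 : E), lieExp G x ∈ φ.source :=
    h1.continuousAt.preimage_mem_nhds (extChartAt_source_mem_nhds _)
  constructor
  · have h6 := h5.map_nhds_eq_of_equiv
    have h7 := congrArg (Filter.map φ.symm) h6
    rw [Filter.map_map, Filter.map_congr (m₁ := φ.symm ∘ fun x : E => φ (lieExp G x))
      (m₂ := lieExp G) (hsrc.mono fun x hx => φ.left_inv hx)] at h7
    rw [h7]
    have h8 := map_extChartAt_symm_nhdsWithin_range (I := 𝓘(ℝ, E)) (lieExp G (0 : E))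
    rw [modelWithCornersSelf_coe, Set.range_id, nhdsWithin_univ] at h8
    rw [h8, lieExp_zero]
  · refine ⟨(h5.toOpenPartialHomeomorph _).source, ?_, fun x hx y hy hxy => ?_⟩
    · exact (h5.toOpenPartialHomeomorph _).open_source.mem_nhds
        h5.mem_toOpenPartialHomeomorph_source
    · exact (h5.toOpenPartialHomeomorph _).injOn hx hy (congrArg φ hxy)

/-- The Baker–Campbell–Hausdorff group law `X * Y = X + Y + b X Y / 2` on a vector space with an
alternating bilinear bracket `b` of nilpotency class two. -/
@[reducible] noncomputable def bchGroup (b : E →ₗ[ℝ] E →ₗ[ℝ] E) (hb : b.IsAlt)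
    (hb2 : ∀ X Y Z, b (b X Y) Z = 0) : Group E where
  mul X Y := X + Y + (1 / 2 : ℝ) • b X Y
  one := 0
  inv X := -X
  mul_assoc X Y Z := by
    have hb3 : ∀ X Y Z, b X (b Y Z) = 0 := fun X Y Z => by rw [← hb.neg, hb2, neg_zero]
    change X + Y + (1 / 2 : ℝ) • b X Y + Z + (1 / 2 : ℝ) • b (X + Y + (1 / 2 : ℝ) • b X Y) Z =
      X + (Y + Z + (1 / 2 : ℝ) • b Y Z) + (1 / 2 : ℝ) • b X (Y + Z + (1 / 2 : ℝ) • b Y Z)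
    simp only [map_add, map_smul, LinearMap.add_apply, LinearMap.smul_apply, hb2, hb3, smul_add]
    simp only [smul_zero, add_zero]
    abel
  one_mul X := by
    change 0 + X + (1 / 2 : ℝ) • b 0 X = X
    simp
  mul_one X := by
    change X + 0 + (1 / 2 : ℝ) • b X 0 = X
    simp
  inv_mul_cancel X := by
    change -X + X + (1 / 2 : ℝ) • b (-X) X = 0
    simp [hb.self_eq_zero]

/-- The exponential map of a connected Lie group `G` of nilpotency class two is a covering map: it
is a homomorphism from the Lie algebra with the Baker–Campbell–Hausdorff group law onto `G`, and
a local homeomorphism at `0`. -/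
theorem isCoveringMap_lieExp [ConnectedSpace G] (hcl : ∀ x y k : G, Commute ⁅x, y⁆ k) :
    IsCoveringMap (lieExp G : E → G) := by
  have := topologicalGroup_of_lieGroup 𝓘(ℝ, E) ∞ (G := G)
  obtain ⟨b, hb1, hb2, hb3, hb4⟩ := exists_bilinear_lieExp_mul (E := E) hcl
  obtain ⟨hmap, U, hU, hinj⟩ := map_nhds_zero_lieExp_and_exists_injOn (E := E) hcl
  let _ : Group E := bchGroup b hb3 hb4
  have : IsTopologicalGroup E :=
    { continuous_mul := by
        change Continuous fun p : E × E =>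
          p.1 + p.2 + (1 / 2 : ℝ) • b.toContinuousBilinearMap p.1 p.2
        fun_prop
      continuous_inv := continuous_neg }
  let f : E →* G :=
    { toFun := lieExp G
      map_one' := lieExp_zero
      map_mul' := fun X Y => (hb2 X Y).symm }
  have hcont : Continuous f := (contMDiff_lieExp (E := E) hcl).continuous
  have hrange : f.range = ⊤ := by
    apply Subgroup.eq_top_of_mem_nhds_one
    rw [← hmap]
    exact Filter.mem_map.2 (Filter.univ_mem' fun x => ⟨x, rfl⟩)
  have hopen : IsOpenMap f := IsTopologicalGroup.isOpenMap_iff_nhds_one.2 hmap.ge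
  have hdisc : IsDiscrete (f.ker : Set E) := by
    obtain ⟨V, hVU, hVo, hV0⟩ := mem_nhds_iff.1 hU
    rw [SetLike.isDiscrete_iff_discreteTopology]
    refine discreteTopology_of_isOpen_singleton_one ⟨V, hVo, ?_⟩
    ext x
    refine ⟨fun hx => Subtype.ext (hinj (hVU hx) (mem_of_mem_nhds hU) ?_), fun hx => ?_⟩
    · exact (f.mem_ker.1 x.2).trans lieExp_zero.symm
    · rw [Set.mem_singleton_iff.1 hx]
      exact hV0
  exact ((hopen.isQuotientMap hcont
    (MonoidHom.range_eq_top.1 hrange)).isQuotientCoveringMap_of_isDiscrete_ker_monoidHom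
      hdisc).isCoveringMap

/-- In a simply connected Lie group of nilpotency class two the powers of any `z ≠ 1` escape from
every compact set, as the exponential map is a homeomorphism. -/
theorem exists_forall_pow_notMem_of_simplyConnected
    (E : Type*) [NormedAddCommGroup E] [NormedSpace ℝ E] [FiniteDimensional ℝ E]
    {G : Type*} [Group G] [TopologicalSpace G] [ChartedSpace E G] [LieGroup 𝓘(ℝ, E) ∞ G]
    [T2Space G] [ConnectedSpace G] [SimplyConnectedSpace G]
    (hcl : ∀ x y k : G, Commute ⁅x, y⁆ k) {z : G} (hz : z ≠ 1) {K : Set G} (hK : IsCompact K) :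
    ∃ n₀ : ℕ, ∀ n ≥ n₀, z ^ n ∉ K := by
  have hcov := isCoveringMap_lieExp (E := E) hcl
  have : LocallyPathConnectedSpace G := ChartedSpace.locallyPathConnectedSpace E G
  -- the section of the exponential map obtained by lifting the identity of `G`
  obtain ⟨σ, ⟨hσ1, hσ⟩, -⟩ := hcov.existsUnique_continuousMap_lifts (ContinuousMap.id G) 1 (0 : E)
    (by simp)
  have hσe : ∀ X : E, σ (lieExp G X) = X := by
    have := hcov.eq_of_comp_eq (g₁ := fun X : E => σ (lieExp G X)) (g₂ := id)
      (σ.continuous.comp hcov.continuous) continuous_id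
      (by ext X; exact congrFun hσ (lieExp G X)) 0 (by simp [hσ1])
    exact congrFun this
  have hzσ : lieExp G (σ z) = z := congrFun hσ z
  have hC : 0 < ‖σ z‖ := by
    rw [norm_pos_iff]
    intro h0
    rw [h0, lieExp_zero] at hzσ
    exact hz hzσ.symm
  obtain ⟨R, hR⟩ := (hK.image σ.continuous).isBounded.exists_norm_le
  obtain ⟨n₀, hn₀⟩ := exists_nat_gt (R / ‖σ z‖)
  refine ⟨n₀, fun n hn hmem => ?_⟩
  have h1 : σ (z ^ n) = (n : ℝ) • σ z := by
    rw [← hσe ((n : ℝ) • σ z), lieExp_natCast_smul, hzσ]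
  have h2 := hR _ ⟨_, hmem, rfl⟩
  rw [h1, norm_smul, Real.norm_natCast] at h2
  have h3 : R < n₀ * ‖σ z‖ := (div_lt_iff₀ hC).1 hn₀
  have h4 : (n₀ : ℝ) * ‖σ z‖ ≤ n * ‖σ z‖ := by gcongr
  linarith

end Covering

theorem mainTheorem11
    {E : Type*} [NormedAddCommGroup E] [NormedSpace ℝ E] [FiniteDimensional ℝ E]
    {G : Type*} [Group G] [TopologicalSpace G] [ChartedSpace E G] [LieGroup 𝓘(ℝ, E) ∞ G]
    [ConnectedSpace G] [SimplyConnectedSpace G] [Group.IsNilpotent G]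
    (hG : ∃ a b : G, a * b ≠ b * a) :
    ∃ Γ : Set G, Separated Γ ∧ ¬ RelativelySeparated Γ⁻¹ := by
  have := topologicalGroup_of_lieGroup 𝓘(ℝ, E) ∞ (G := G)
  have : T1Space G := ChartedSpace.t1Space E G
  have : LocallyCompactSpace G := ChartedSpace.locallyCompactSpace E G
  have : FirstCountableTopology G := ⟨fun x => by
    have h := map_extChartAt_symm_nhdsWithin_range (I := 𝓘(ℝ, E)) x
    rw [← h]
    infer_instance⟩
  have hZ1 : Subgroup.upperCentralSeries G 1 ≠ ⊤ := by
    intro h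
    obtain ⟨a, b, hab⟩ := hG
    apply hab
    have : b ∈ Subgroup.upperCentralSeries G 1 := by rw [h]; trivial
    rw [Subgroup.upperCentralSeries_one, Subgroup.mem_center_iff] at this
    exact this a
  refine exists_separated_inv_not_relativelySeparated fun W hW U hU N => ?_
  by_cases hZ2 : Subgroup.upperCentralSeries G 2 = ⊤
  · have hcl : ∀ x y k : G, Commute ⁅x, y⁆ k := by
      intro x y k
      have hx : x ∈ Subgroup.upperCentralSeries G 2 := by rw [hZ2]; trivial
      have := Subgroup.mem_upperCentralSeries_succ_iff.1 hx y
      rw [Subgroup.upperCentralSeries_one, Subgroup.mem_center_iff] at this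
      exact (this k).symm
    refine exists_conj_pow_notMem (j := 0) hZ1 (fun z _ hz K hK => ?_) hW hU N
    simpa using exists_forall_pow_notMem_of_simplyConnected E hcl (z := z) (by simpa using hz) hK
  · exact exists_conj_pow_notMem (j := 1) hZ2
      (fun z hz2 hz1 K hK => exists_forall_pow_notMem_mul_center E hz2 hz1 hK) hW hU N
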